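/- All structures considered have domain $\omega$, and Boolean algebras are structures in the signature $\{\vee,\wedge,\neg,0,1\}$, where each operation is identified with its graph (so the symbols become relations $P_0,\dots,P_4$ of arities $3,3,2,1,1$). All classes of structures are closed under isomorphism (among structures with domain $\omega$). An effective enumeration of a class $\mathfrak{K}$ is a function $\nu\colon\omega\to\mathfrak{K}$ such that the sequence of structures $(\nu(e))_{e\in\omega}$ is uniformly computable and every $\mathcal{A}\in\mathfrak{K}$ is isomorphic to some $\nu(e)$. An informant for a structure $\mathcal{A}=(\omega;P_0,\dots,P_4)$, with $P_j\subseteq\omega^{n_j}$, is a function $I=(I_0,\dots,I_4)$ on $\omega$ with $I_j(m)\in\omega^{n_j}\times\{0,1\}$ such that, for every $j$, $\{\bar a : (\bar a,1)\in\operatorname{range}(I_j)\}=P_j$ and $\{\bar a : (\bar a,0)\in\operatorname{range}(I_j)\}=\omega^{n_j}\setminus P_j$. A learner is an arbitrary (not necessarily computable) function $M$ from finite initial segments $I[s]=(I(0),\dots,I(s-1))$ of such sequences to $\omega\cup\{?\}$. For $\mathfrak{C}\subseteq\mathfrak{K}$, the class $\mathfrak{C}$ is $\mathbf{InfEx}_{\cong}[\nu]$-learnable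 if there is a learner $M$ such that for every $\mathcal{A}\in\mathfrak{C}$ and every informant $I$ for $\mathcal{A}$ there are $e$ and $s_0$ with $\nu(e)\cong\mathcal{A}$ and $M(I[s])=e$ for all $s\ge s_0$. Proposition. Let $\mathfrak{K}$ be a class of infinite Boolean algebras, and let $\nu$ be an effective enumeration of $\mathfrak{K}$. If $\mathfrak{C}$ is a subclass of $\mathfrak{K}$ which contains at least two non-isomorphic members, then $\mathfrak{C}$ is not $\mathbf{InfEx}_{\cong}[\nu]$-learnable. -/

import Mathlib

namespace InformantLearning

open FirstOrder

section General

variable {L : Language}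

/-- The arity of a symbol once function symbols are replaced by their graphs: an `n`-ary function
symbol becomes an `(n+1)`-ary relation (a constant becomes a unary one). -/
def arity : L.Symbols → ℕ
  | Sum.inl f => f.1 + 1
  | Sum.inr r => r.1

/-- The relation on the domain `ω` that interprets a symbol in `A`: the graph
`f(a₀,…,aₙ₋₁) = aₙ` of a function symbol, and the interpretation of a relation symbol. -/
def rel (A : L.Structure ℕ) : (s : L.Symbols) → Set (Fin (arity s) → ℕ)
  | Sum.inl f => {a | A.funMap f.2 (fun i : Fin f.1 => a i.castSucc) = a (Fin.last f.1)}
  | Sum.inr r => {a | A.RelMap r.2 a}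

/-- Two `L`-structures with domain `ω` are isomorphic. -/
def Isomorphic (A B : L.Structure ℕ) : Prop :=
  Nonempty (@Language.Equiv L ℕ ℕ A B)

/-- A class of structures with domain `ω` is closed under isomorphisms. -/
def IsoClosed (K : Set (L.Structure ℕ)) : Prop :=
  ∀ A B : L.Structure ℕ, A ∈ K → Isomorphic A B → B ∈ K

/-- A sequence of structures in a finite signature is uniformly computable: for every symbol,
one algorithm decides its interpretation in the `e`-th structure, given `e` and a tuple. -/
def UniformlyComputable [Finite L.Symbols] (ν : ℕ → L.Structure ℕ) : Prop :=
  ∀ s : L.Symbols,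
    ComputablePred fun p : ℕ × (Fin (arity s) → ℕ) => p.2 ∈ rel (ν p.1) s

/-- `ν` is an effective enumeration of the class `K`. -/
structure IsEffectiveEnumeration [Finite L.Symbols] (K : Set (L.Structure ℕ))
    (ν : ℕ → L.Structure ℕ) : Prop where
  mem : ∀ e, ν e ∈ K
  uniformlyComputable : UniformlyComputable ν
  exists_isomorphic : ∀ A ∈ K, ∃ e, Isomorphic A (ν e)

/-- One value of an informant: for each symbol, a tuple together with a truth value. -/
abbrev Datum (L : Language) : Type _ :=
  (s : L.Symbols) → (Fin (arity s) → ℕ) × Bool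

/-- The tuples that `I` lists as satisfying the symbol `s`. -/
def contentPos (I : ℕ → Datum L) (s : L.Symbols) : Set (Fin (arity s) → ℕ) :=
  {a | ∃ m, I m s = (a, true)}

/-- The tuples that `I` lists as not satisfying the symbol `s`. -/
def contentNeg (I : ℕ → Datum L) (s : L.Symbols) : Set (Fin (arity s) → ℕ) :=
  {a | ∃ m, I m s = (a, false)}

/-- `I` is an informant for `A`: its positive data are exactly the true facts, and its negative
data exactly the false ones. -/
def IsInformantFor (I : ℕ → Datum L) (A : L.Structure ℕ) : Prop :=
  ∀ s : L.Symbols, contentPos I s = rel A s ∧ contentNeg I s = (rel A s)ᶜ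

/-- The initial segment `I(0), …, I(n-1)`. -/
def initSeg (I : ℕ → Datum L) (n : ℕ) : List (Datum L) :=
  (List.range n).map I

/-- A learner: an arbitrary function from finite sequences of data to conjectures in `ω ∪ {?}`,
where `none` stands for `?`. -/
abbrev Learner (L : Language) : Type _ :=
  List (Datum L) → Option ℕ

/-- The class `C` is `InfEx_≅[ν]`-learnable. -/
def IsLearnable (ν : ℕ → L.Structure ℕ) (C : Set (L.Structure ℕ)) : Prop :=
  ∃ M : Learner L, ∀ A ∈ C, ∀ I : ℕ → Datum L, IsInformantFor I A →
    ∃ e s₀ : ℕ, Isomorphic (ν e) A ∧ ∀ s ≥ s₀, M (initSeg I s) = some e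

end General

section BooleanAlgebras

/-- The operation symbols of Boolean algebras. -/
inductive BoolFunc : ℕ → Type
  | sup : BoolFunc 2
  | inf : BoolFunc 2
  | compl : BoolFunc 1
  | bot : BoolFunc 0
  | top : BoolFunc 0

/-- The signature `{∨, ∧, ¬, 0, 1}` of Boolean algebras. -/
def boolLang : Language where
  Functions := BoolFunc
  Relations := fun _ => Empty

instance : Finite boolLang.Symbols := by
  apply Finite.of_surjective
    (fun i : Fin 5 => (Sum.inl ((![⟨2, BoolFunc.sup⟩, ⟨2, BoolFunc.inf⟩, ⟨1, BoolFunc.compl⟩,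
      ⟨0, BoolFunc.bot⟩, ⟨0, BoolFunc.top⟩] : Fin 5 → Σ n, BoolFunc n) i) : boolLang.Symbols))
  rintro (⟨n, f⟩ | ⟨n, r⟩)
  · cases f
    · exact ⟨0, rfl⟩
    · exact ⟨1, rfl⟩
    · exact ⟨2, rfl⟩
    · exact ⟨3, rfl⟩
    · exact ⟨4, rfl⟩
  · exact r.elim

/-- A Boolean algebra as a structure in the signature `{∨, ∧, ¬, 0, 1}`. -/
@[reducible] def boolStructure (α : Type*) [BooleanAlgebra α] : boolLang.Structure α where
  funMap := fun {_} f => match f with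
    | BoolFunc.sup => fun x => x 0 ⊔ x 1
    | BoolFunc.inf => fun x => x 0 ⊓ x 1
    | BoolFunc.compl => fun x => (x 0)ᶜ
    | BoolFunc.bot => fun _ => ⊥
    | BoolFunc.top => fun _ => ⊤
  RelMap := fun {_} r => r.elim

/-- The structure `A` with domain `ω` is a (necessarily infinite) Boolean algebra. The algebra
operations on `ω` are arbitrary, unrelated to the arithmetic of `ω`. -/
def IsBooleanAlgebra (A : boolLang.Structure ℕ) : Prop :=
  ∃ b : BooleanAlgebra ℕ, A = @boolStructure ℕ b

end BooleanAlgebras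

end InformantLearning

/-! Given two non-isomorphic algebras in the class, call them `α` and `β` so that the atoms of `β`
inject into those of `α`. The aim is one conjecture `e` that must be right for both.

A Blum–Blum locking argument on copies of `β` gives finite data, with finitely many elements of `β`
named, such that every correct extension keeps the conjecture `e` (`exists_locking_condition`). The
named tuple is then moved to `α` so that whatever `α` shows later can still be imitated by `β` over
the original tuple (`exists_matched_extendable`). An informant for a copy of `α` that begins with
the locking data makes the learner converge, yet each long enough segment of it is also data of `β`
extending the condition. So its limit is `e`, and `e` is right for `α`; it is right for `β` by
locking.

The transfer uses finite partitions. Equations between joins of members depend only on which members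
are zero. Finite nonzero members on the `β` side become atoms of `α`, which is where the atom count
is needed: atoms cannot be refined, while infinite members of `β` can be split into as many nonzero
parts as `α` demands. -/

namespace InformantLearning

open FirstOrder

/-! ### Finite partitions of Boolean algebras and their transfer -/

section Partitions

variable {α β : Type*} [BooleanAlgebra α] [BooleanAlgebra β] {τ : Type} [Fintype τ]

/-- The atoms of a Boolean algebra. -/
abbrev AtomOf (α : Type*) [BooleanAlgebra α] : Type _ :=
  {a : α // IsAtom a}

/-- A finite family of pairwise disjoint elements with join `⊤`; the members may be `⊥`. -/
structure IsPartition (y : τ → α) : Prop where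
  disjoint : ∀ s t, s ≠ t → Disjoint (y s) (y t)
  sup_eq_top : Finset.univ.sup y = ⊤

theorem IsPartition.sup_le_sup_iff {y : τ → α} (hy : IsPartition y) {S T : Finset τ} :
    S.sup y ≤ T.sup y ↔ ∀ t ∈ S, y t ≠ ⊥ → t ∈ T := by
  constructor
  · intro h t ht h0
    by_contra hT
    have h1 : Disjoint (y t) (T.sup y) :=
      Finset.disjoint_sup_right.2 fun u hu => hy.disjoint t u (by rintro rfl; exact hT hu)
    exact h0 (h1.eq_bot_of_le ((Finset.le_sup ht).trans h))
  · intro h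
    refine Finset.sup_le fun t ht => ?_
    by_cases h0 : y t = ⊥
    · simp [h0]
    · exact Finset.le_sup (h t ht h0)

theorem IsPartition.compl_sup [DecidableEq τ] {y : τ → α} (hy : IsPartition y) (S : Finset τ) :
    (S.sup y)ᶜ = Sᶜ.sup y := by
  refine IsCompl.compl_eq ⟨?_, ?_⟩
  · refine Finset.disjoint_sup_left.2 fun s hs => Finset.disjoint_sup_right.2 fun t ht => ?_
    exact hy.disjoint s t (by rintro rfl; simp_all)
  · rw [codisjoint_iff, ← Finset.sup_union, Finset.union_compl, hy.sup_eq_top]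

theorem IsPartition.sup_inf_sup [DecidableEq τ] {y : τ → α} (hy : IsPartition y)
    (S T : Finset τ) : S.sup y ⊓ T.sup y = (S ∩ T).sup y := by
  rw [← compl_inj_iff, compl_inf, hy.compl_sup, hy.compl_sup, hy.compl_sup, ← Finset.sup_union,
    Finset.compl_inter]

/-- The order between joins of members is determined by the set of zero members, so two partitions
with the same zero pattern satisfy the same equations. -/
theorem IsPartition.sup_eq_sup_iff {y : τ → α} {x : τ → β} (hy : IsPartition y)
    (hx : IsPartition x) (h : ∀ t, y t = ⊥ ↔ x t = ⊥) {S T : Finset τ} :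
    S.sup y = T.sup y ↔ S.sup x = T.sup x := by
  rw [le_antisymm_iff, le_antisymm_iff]
  simp only [hy.sup_le_sup_iff, hx.sup_le_sup_iff, ne_eq, h]

/-- Every partition has a refinement in which given finitely many elements are joins of
members. -/
theorem IsPartition.exists_refinement {y : τ → α} (hy : IsPartition y) (a : ℕ → α) (m : ℕ) :
    ∃ (τ' : Type) (_ : Fintype τ') (π : τ' → τ) (y' : τ' → α), IsPartition y' ∧
      (∀ t, y' t ≤ y (π t)) ∧ ∀ j < m, ∃ S : Finset τ', S.sup y' = a j := by
  classical
  induction m with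
  | zero => exact ⟨τ, inferInstance, id, y, hy, fun _ => le_rfl, by simp⟩
  | succ m ih =>
    obtain ⟨τ', _, π, y', hy', hle, hS⟩ := ih
    have key : ∀ S : Finset τ', (S ×ˢ (Finset.univ : Finset Bool)).sup
        (fun t => y' t.1 ⊓ bif t.2 then a m else (a m)ᶜ) = S.sup y' := by
      intro S
      rw [Finset.sup_product_left]
      refine Finset.sup_congr rfl fun t _ => ?_
      simp [← inf_sup_left]
    -- Each member is cut by `a m` and its complement; some pieces may be `⊥`, which partitions
    -- allow. `key` says that old joins survive the cut.
    refine ⟨τ' × Bool, inferInstance, fun t => π t.1,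
      fun t => y' t.1 ⊓ bif t.2 then a m else (a m)ᶜ, ⟨?_, ?_⟩,
      fun t => inf_le_left.trans (hle t.1), ?_⟩
    · rintro ⟨s, p⟩ ⟨t, q⟩ hne
      by_cases hst : s = t
      · have hpq : p ≠ q := by rintro rfl; exact hne (by rw [hst])
        refine Disjoint.mono inf_le_right inf_le_right ?_
        cases p <;> cases q <;> simp_all [disjoint_compl_left, disjoint_compl_right]
      · exact (hy'.disjoint s t hst).mono inf_le_left inf_le_left
    · rw [← hy'.sup_eq_top, ← key, Finset.univ_product_univ]
    · intro j hj
      rcases Nat.lt_succ_iff_lt_or_eq.1 hj with hj | rfl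
      · obtain ⟨S, hS⟩ := hS j hj
        exact ⟨_, (key S).trans hS⟩
      · refine ⟨Finset.univ ×ˢ {true}, ?_⟩
        rw [Finset.sup_product_left]
        simp only [Finset.sup_singleton, cond_true]
        rw [← Finset.sup_inf_distrib_right, hy'.sup_eq_top, top_inf_eq]

theorem IsPartition.eq_sup_of_refinement {τ' : Type} [Fintype τ'] [DecidableEq τ] {y : τ → α}
    (hy : IsPartition y) {π : τ' → τ} {y' : τ' → α} (hy' : IsPartition y')
    (hle : ∀ t, y' t ≤ y (π t)) (s : τ) :
    y s = (Finset.univ.filter fun t => π t = s).sup y' := by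
  classical
  refine le_antisymm ?_ (Finset.sup_le fun t ht => ?_)
  · rw [← inf_top_eq (y s), ← hy'.sup_eq_top, Finset.sup_inf_distrib_left]
    refine Finset.sup_le fun t _ => ?_
    by_cases h : π t = s
    · exact inf_le_right.trans (Finset.le_sup (f := y') (by simp [h]))
    · have := (hy.disjoint s (π t) (Ne.symm h)).mono_right (hle t)
      rw [this.eq_bot]
      exact bot_le
  · have := (Finset.mem_filter.1 ht).2
    exact this ▸ hle t

theorem finite_Iic_sup {a b : α} (ha : (Set.Iic a).Finite) (hb : (Set.Iic b).Finite) :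
    (Set.Iic (a ⊔ b)).Finite := by
  -- An element below `a ⊔ b` is determined by its traces on `a` and `b`.
  refine Set.Finite.of_finite_image (f := fun z => (z ⊓ a, z ⊓ b))
    ((ha.prod hb).subset ?_) ?_
  · rintro _ ⟨z, -, rfl⟩
    exact ⟨inf_le_right, inf_le_right⟩
  · intro z hz w hw h
    simp only [Prod.mk.injEq] at h
    rw [← inf_eq_left.2 (Set.mem_Iic.1 hz), ← inf_eq_left.2 (Set.mem_Iic.1 hw), inf_sup_left,
      inf_sup_left, h.1, h.2]

theorem finite_Iic_finset_sup {ι : Type*} (S : Finset ι) (y : ι → α)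
    (h : ∀ s ∈ S, (Set.Iic (y s)).Finite) : (Set.Iic (S.sup y)).Finite := by
  classical
  induction S using Finset.induction_on with
  | empty => simp
  | insert s S _ ih =>
    rw [Finset.sup_insert]
    exact finite_Iic_sup (h s (by simp)) (ih fun t ht => h t (by simp [ht]))

/-- Cut `x` by any `z` strictly between `⊥` and `x`: one of `z`, `x \ z` still has infinitely many
elements below it, and serves as `v`. -/
theorem exists_split_of_infinite {x : α} (hx : (Set.Iic x).Infinite) :
    ∃ u v, u ≠ ⊥ ∧ (Set.Iic v).Infinite ∧ Disjoint u v ∧ u ⊔ v = x := by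
  obtain ⟨z, hz, hz'⟩ := hx.exists_notMem_finite (Set.toFinite {⊥, x})
  simp only [Set.mem_insert_iff, Set.mem_singleton_iff, not_or] at hz'
  have hzx : z ⊔ x \ z = x := sup_sdiff_cancel_right hz
  by_cases hf : (Set.Iic z).Finite
  · refine ⟨z, x \ z, hz'.1, fun h => hx ?_, disjoint_sdiff_self_right, hzx⟩
    exact hzx ▸ finite_Iic_sup hf h
  · refine ⟨x \ z, z, fun h => hz'.2 ?_, hf, disjoint_sdiff_self_left, by rw [sup_comm, hzx]⟩
    exact le_antisymm hz (sdiff_eq_bot_iff.1 h)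

/-- An element with infinitely many elements below it splits into any positive finite number of
nonzero parts. -/
theorem exists_parts_of_infinite {ι : Type*} {S : Finset ι} (hS : S.Nonempty) :
    ∀ {x : α}, (Set.Iic x).Infinite → ∃ p : ι → α, (∀ t ∈ S, p t ≠ ⊥) ∧
      (∀ s ∈ S, ∀ t ∈ S, s ≠ t → Disjoint (p s) (p t)) ∧ S.sup p = x := by
  classical
  induction hS using Finset.Nonempty.cons_induction with
  | singleton t =>
    intro x hx
    refine ⟨fun _ => x, ?_, by simp, by simp⟩
    rintro - - rfl
    simp at hx
  | cons t S ht hS ih =>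
    intro x hx
    obtain ⟨u, v, hu, hv, huv, rfl⟩ := exists_split_of_infinite hx
    obtain ⟨p, hp, hd, rfl⟩ := ih hv
    have hpS : ∀ s ∈ S, Function.update p t u s = p s := fun s hs =>
      Function.update_of_ne (by rintro rfl; exact ht hs) _ _
    have hdu : ∀ s ∈ S, Disjoint u (p s) := fun s hs => huv.mono_right (Finset.le_sup hs)
    refine ⟨Function.update p t u, ?_, ?_, ?_⟩
    · intro s hs
      rcases Finset.mem_cons.1 hs with rfl | hs
      · simpa using hu
      · rw [hpS s hs]; exact hp s hs
    · intro r hr s hs hrs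
      rcases Finset.mem_cons.1 hr with rfl | hr' <;> rcases Finset.mem_cons.1 hs with rfl | hs'
      · exact absurd rfl hrs
      · rw [hpS s hs', Function.update_self]; exact hdu s hs'
      · rw [hpS r hr', Function.update_self]; exact (hdu r hr').symm
      · rw [hpS r hr', hpS s hs']; exact hd r hr' s hs' hrs
    · rw [Finset.sup_cons, Function.update_self, Finset.sup_congr rfl hpS]

theorem exists_isAtom_le_of_finite {x : α} (hx : (Set.Iic x).Finite) (h0 : x ≠ ⊥) :
    ∃ u, IsAtom u ∧ u ≤ x := by
  have : Finite (Set.Iic x) := hx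
  obtain ⟨u, hu, hux⟩ := (eq_bot_or_exists_atom_le (⟨x, le_rfl⟩ : Set.Iic x)).resolve_left
    (fun h => h0 (congrArg Subtype.val h))
  exact ⟨u.1, hu.of_isAtom_coe_Iic, u.2⟩

/-- If `α` has at least as many atoms as `β`, then every finite partition of `β` is matched by
one of `α` in which the finite nonzero members have turned into atoms. -/
theorem IsPartition.exists_matching [Infinite α] [Infinite β]
    (j : AtomOf β ↪ AtomOf α) {x : τ → β} (hx : IsPartition x) :
    ∃ y : τ → α, IsPartition y ∧ (∀ t, y t = ⊥ ↔ x t = ⊥) ∧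
      ∀ t, (Set.Iic (x t)).Finite → x t ≠ ⊥ → IsAtom (y t) := by
  classical
  -- One atom is chosen below each finite nonzero member. Disjoint members give distinct atoms, and
  -- `j` sends these to distinct, hence disjoint, atoms of `α`.
  have hatom : ∀ t, (Set.Iic (x t)).Finite ∧ x t ≠ ⊥ → ∃ u : AtomOf β, u.1 ≤ x t :=
    fun t ht => let ⟨u, hu, hut⟩ := exists_isAtom_le_of_finite ht.1 ht.2; ⟨⟨u, hu⟩, hut⟩
  choose u hu using hatom
  set F : τ → Prop := fun t => (Set.Iic (x t)).Finite ∧ x t ≠ ⊥ with hF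
  let v : τ → α := fun t => if h : F t then (j (u t h)).1 else ⊥
  have hvF : ∀ t, F t → IsAtom (v t) := fun t h => by
    simp only [v, dif_pos h]; exact (j (u t h)).2
  have hvd : ∀ s t, F s → F t → s ≠ t → Disjoint (v s) (v t) := by
    intro s t hs ht hst
    refine (hvF s hs).disjoint_of_ne (hvF t ht) fun h => ?_
    simp only [v, dif_pos hs, dif_pos ht] at h
    have h' : u s hs = u t ht := j.injective (Subtype.ext h)
    refine (u s hs).2.1 (((hx.disjoint s t hst).mono (hu s hs) (h' ▸ hu t ht)).eq_bot_of_self)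
  have hvfin : (Set.Iic ((Finset.univ.filter F).sup v)).Finite := by
    refine finite_Iic_finset_sup _ _ fun t ht => ?_
    rw [(hvF t (Finset.mem_filter.1 ht).2).Iic_eq]
    exact Set.toFinite _
  -- What the chosen atoms leave of `α` is infinite, so it can be shared out among the indices of
  -- the infinite members.
  have hrinf : (Set.Iic ((Finset.univ.filter F).sup v)ᶜ).Infinite := by
    intro h
    have := finite_Iic_sup hvfin h
    rw [sup_compl_eq_top, Set.Iic_top] at this
    exact Set.infinite_univ this
  -- Since `β` is infinite, some member is infinite, so the remainder has at least one recipient.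
  have hne : (Finset.univ.filter fun t => (Set.Iic (x t)).Infinite).Nonempty := by
    by_contra h
    rw [Finset.not_nonempty_iff_eq_empty, Finset.filter_eq_empty_iff] at h
    have := finite_Iic_finset_sup Finset.univ x fun t ht => Set.not_infinite.1 (h ht)
    rw [hx.sup_eq_top, Set.Iic_top] at this
    exact Set.infinite_univ this
  obtain ⟨p, hp, hpd, hps⟩ := exists_parts_of_infinite hne hrinf
  simp only [Finset.mem_filter, Finset.mem_univ, true_and] at hp hpd
  have hpv : ∀ s t, F s → (Set.Iic (x t)).Infinite → Disjoint (v s) (p t) := fun s t hs ht =>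
    disjoint_compl_right.mono (Finset.le_sup (f := v) (by simpa using hs))
      (hps ▸ Finset.le_sup (f := p) (by simpa using ht))
  have hcases : ∀ t, F t ∨ (Set.Iic (x t)).Infinite ∨ x t = ⊥ := by
    intro t
    by_cases h1 : (Set.Iic (x t)).Finite
    · by_cases h2 : x t = ⊥
      · exact Or.inr (Or.inr h2)
      · exact Or.inl ⟨h1, h2⟩
    · exact Or.inr (Or.inl h1)
  have hbotfin : ∀ t, x t = ⊥ → (Set.Iic (x t)).Finite := fun t h => by simp [h]
  let y : τ → α := fun t => if F t then v t else if (Set.Iic (x t)).Infinite then p t else ⊥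
  have hyF : ∀ t, F t → y t = v t := fun t h => if_pos h
  have hyI : ∀ t, (Set.Iic (x t)).Infinite → y t = p t := fun t h => by
    have : ¬ F t := fun h' => h h'.1
    simp only [y, if_neg this, if_pos h]
  have hy0 : ∀ t, x t = ⊥ → y t = ⊥ := fun t h => by
    have h1 : ¬ F t := fun h' => h'.2 h
    have h2 : ¬ (Set.Iic (x t)).Infinite := fun h' => h' (hbotfin t h)
    simp only [y, if_neg h1, if_neg h2]
  refine ⟨y, ⟨?_, ?_⟩, ?_, fun t h1 h2 => hyF t ⟨h1, h2⟩ ▸ hvF t ⟨h1, h2⟩⟩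
  · intro s t hst
    rcases hcases s with hs | hs | hs
    · rcases hcases t with ht | ht | ht
      · rw [hyF s hs, hyF t ht]; exact hvd s t hs ht hst
      · rw [hyF s hs, hyI t ht]; exact hpv s t hs ht
      · rw [hy0 t ht]; exact disjoint_bot_right
    · rcases hcases t with ht | ht | ht
      · rw [hyI s hs, hyF t ht]; exact (hpv t s ht hs).symm
      · rw [hyI s hs, hyI t ht]; exact hpd s hs t ht hst
      · rw [hy0 t ht]; exact disjoint_bot_right
    · rw [hy0 s hs]; exact disjoint_bot_left
  · rw [← top_le_iff, ← sup_compl_eq_top (x := (Finset.univ.filter F).sup v), ← hps]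
    refine sup_le (Finset.sup_le fun t ht => ?_) (Finset.sup_le fun t ht => ?_)
    · rw [← hyF t (Finset.mem_filter.1 ht).2]; exact Finset.le_sup (Finset.mem_univ t)
    · rw [← hyI t (Finset.mem_filter.1 ht).2]; exact Finset.le_sup (Finset.mem_univ t)
  · intro t
    refine ⟨fun h => ?_, hy0 t⟩
    rcases hcases t with ht | ht | ht
    · exact absurd (hyF t ht ▸ h) (hvF t ht).1
    · exact absurd (hyI t ht ▸ h) (hp t ht)
    · exact ht

/-- A refinement of one of two partitions matched as in `IsPartition.exists_matching` can be
copied to the other one. -/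
theorem IsPartition.exists_refinement_of_matching {τ' : Type} [Fintype τ'] {y : τ → α} {x : τ → β}
    (hy : IsPartition y) (hx : IsPartition x) (h0 : ∀ t, y t = ⊥ ↔ x t = ⊥)
    (hat : ∀ t, (Set.Iic (x t)).Finite → x t ≠ ⊥ → IsAtom (y t)) {π : τ' → τ} {y' : τ' → α}
    (hy' : IsPartition y') (hle : ∀ t, y' t ≤ y (π t)) :
    ∃ x' : τ' → β, IsPartition x' ∧ (∀ t, x' t ≤ x (π t)) ∧ ∀ t, y' t = ⊥ ↔ x' t = ⊥ := by
  classical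
  let P : τ → Finset τ' := fun s => Finset.univ.filter fun t => π t = s ∧ y' t ≠ ⊥
  have hPne : ∀ s, x s ≠ ⊥ → (P s).Nonempty := by
    intro s hs
    by_contra h
    rw [Finset.not_nonempty_iff_eq_empty, Finset.filter_eq_empty_iff] at h
    refine hs ((h0 s).1 ?_)
    rw [hy.eq_sup_of_refinement hy' hle s, Finset.sup_eq_bot_iff]
    intro t ht
    by_contra h1
    exact h (Finset.mem_univ t) ⟨(Finset.mem_filter.1 ht).2, h1⟩
  have hparts : ∀ s, ∃ p : τ' → β, (∀ t ∈ P s, p t ≠ ⊥) ∧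
      (∀ r ∈ P s, ∀ t ∈ P s, r ≠ t → Disjoint (p r) (p t)) ∧ (P s).sup p = x s := by
    intro s
    by_cases hs : x s = ⊥
    · have hP : P s = ∅ := by
        refine Finset.filter_eq_empty_iff.2 ?_
        rintro t - ⟨rfl, ht⟩
        exact ht (le_bot_iff.1 ((hle t).trans ((h0 _).2 hs).le))
      exact ⟨fun _ => ⊥, by simp [hP], by simp [hP], by simp [hP, hs]⟩
    · by_cases hf : (Set.Iic (x s)).Finite
      -- Here `y s` is an atom, so every nonzero piece inside it equals `y s`. Disjointness then
      -- leaves only one such piece, and `x s` need not be split.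
      · refine ⟨fun _ => x s, fun _ _ => hs, ?_, Finset.sup_const (hPne s hs) _⟩
        intro r hr t ht hrt
        have key : ∀ t ∈ P s, y' t = y s := by
          intro t ht
          obtain ⟨rfl, h1⟩ := (Finset.mem_filter.1 ht).2
          exact ((hat _ hf hs).le_iff.1 (hle t)).resolve_left h1
        have := hy'.disjoint r t hrt
        rw [key r hr, key t ht] at this
        exact absurd this.eq_bot_of_self (hat s hf hs).1
      · exact exists_parts_of_infinite (hPne s hs) hf
  choose p hp hpd hps using hparts
  have hmem : ∀ t, y' t ≠ ⊥ → t ∈ P (π t) := fun t ht => by simp [P, ht]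
  let x' : τ' → β := fun t => if y' t = ⊥ then ⊥ else p (π t) t
  have hx'0 : ∀ t, y' t = ⊥ → x' t = ⊥ := fun t ht => if_pos ht
  have hx' : ∀ t, y' t ≠ ⊥ → x' t = p (π t) t := fun t ht => if_neg ht
  have hxle : ∀ t, x' t ≤ x (π t) := by
    intro t
    by_cases ht : y' t = ⊥
    · rw [hx'0 t ht]; exact bot_le
    · rw [hx' t ht, ← hps]; exact Finset.le_sup (hmem t ht)
  refine ⟨x', ⟨?_, ?_⟩, hxle, ?_⟩
  · intro r t hrt
    by_cases hr : y' r = ⊥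
    · rw [hx'0 r hr]; exact disjoint_bot_left
    by_cases ht : y' t = ⊥
    · rw [hx'0 t ht]; exact disjoint_bot_right
    by_cases hπ : π r = π t
    · rw [hx' r hr, hx' t ht, hπ]
      exact hpd _ r (hπ ▸ hmem r hr) t (hmem t ht) hrt
    · exact (hx.disjoint _ _ hπ).mono (hxle r) (hxle t)
  · rw [← top_le_iff, ← hx.sup_eq_top]
    refine Finset.sup_le fun s _ => ?_
    rw [← hps]
    refine Finset.sup_le fun t ht => ?_
    obtain ⟨rfl, h1⟩ := (Finset.mem_filter.1 ht).2
    rw [← hx' t h1]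
    exact Finset.le_sup (Finset.mem_univ t)
  · intro t
    refine ⟨hx'0 t, fun h => ?_⟩
    by_contra ht
    exact hp _ t (hmem t ht) (hx' t ht ▸ h)

theorem IsPartition.sup_eq_sup_of_refinement {τ' : Type} [Fintype τ'] [DecidableEq τ] {y : τ → α}
    (hy : IsPartition y) {π : τ' → τ} {y' : τ' → α} (hy' : IsPartition y')
    (hle : ∀ t, y' t ≤ y (π t)) (S : Finset τ) :
    S.sup y = (Finset.univ.filter fun t => π t ∈ S).sup y' := by
  refine le_antisymm (Finset.sup_le fun s hs => ?_) (Finset.sup_le fun t ht => ?_)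
  · rw [hy.eq_sup_of_refinement hy' hle s]
    refine Finset.sup_mono fun t ht => ?_
    simp only [Finset.mem_filter, Finset.mem_univ, true_and] at ht ⊢
    exact ht ▸ hs
  · exact (hle t).trans (Finset.le_sup (Finset.mem_filter.1 ht).2)

/-- The first `m` terms of `a` and of `b` are the same joins of members of two finite partitions
that have the same zero members. -/
def Matched (a : ℕ → α) (b : ℕ → β) (m : ℕ) : Prop :=
  ∃ (τ : Type) (_ : Fintype τ) (y : τ → α) (x : τ → β) (S : ℕ → Finset τ),
    IsPartition y ∧ IsPartition x ∧ (∀ t, y t = ⊥ ↔ x t = ⊥) ∧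
      ∀ i < m, a i = (S i).sup y ∧ b i = (S i).sup x

/-- If `α` has at least as many atoms as `β`, then every tuple of `β` is matched by a tuple of
`α` each of whose extensions is matched by an extension of the tuple of `β`. -/
theorem exists_matched_extendable [Infinite α] [Infinite β]
    (j : AtomOf β ↪ AtomOf α) (b : ℕ → β) (n : ℕ) :
    ∃ a : ℕ → α, Matched a b n ∧ ∀ a' : ℕ → α, (∀ i < n, a' i = a i) → ∀ m,
      ∃ b' : ℕ → β, (∀ i < n, b' i = b i) ∧ Matched a' b' m := by
  classical
  have htriv : IsPartition (fun _ : Unit => (⊤ : β)) := ⟨by simp, by simp⟩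
  obtain ⟨τ, _, -, x, hx, -, hS⟩ := htriv.exists_refinement b n
  choose! S hS using hS
  obtain ⟨y, hy, h0, hat⟩ := hx.exists_matching j
  refine ⟨fun i => (S i).sup y, ⟨τ, _, y, x, S, hy, hx, h0, fun i hi => ⟨rfl, (hS i hi).symm⟩⟩, ?_⟩
  intro a' ha' m
  obtain ⟨τ', _, π, y', hy', hle, hT⟩ := hy.exists_refinement a' m
  choose! T hT using hT
  obtain ⟨x', hx', hxle, h0'⟩ := hy.exists_refinement_of_matching hx h0 hat hy' hle
  -- The old terms keep their values and are re-expressed in the refinement by pulling `S i` back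
  -- along `π`; the new terms copy the joins found in `α`.
  refine ⟨fun i => if i < n then b i else (T i).sup x', fun i hi => if_pos hi, τ', _, y', x',
    fun i => if i < n then Finset.univ.filter fun t => π t ∈ S i else T i, hy', hx', h0', ?_⟩
  intro i hi
  by_cases hin : i < n
  · simp only [if_pos hin]
    rw [ha' i hin, ← hS i hin]
    exact ⟨hy.sup_eq_sup_of_refinement hy' hle _, hx.sup_eq_sup_of_refinement hx' hxle _⟩
  · simp only [if_neg hin, hT i hi, and_self]

end Partitions

/-! ### Numbered copies, finite data and informants -/

section Copies

variable {L : Language} {β : Type*} [L.Structure β]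

/-- The structure with domain `ω` obtained by numbering the elements of a structure. -/
@[reducible] def copy (f : ℕ ≃ β) : L.Structure ℕ :=
  f.symm.inducedStructure

/-- `A` and `B` have the same facts about the numbers below `n`. -/
def AgreeBelow (A B : L.Structure ℕ) (n : ℕ) : Prop :=
  ∀ (s : L.Symbols) (a : Fin (arity s) → ℕ), (∀ i, a i < n) → (a ∈ rel A s ↔ a ∈ rel B s)

/-- The data in `σ` are facts of `A`. -/
def Correct (σ : List (Datum L)) (A : L.Structure ℕ) : Prop :=
  ∀ d ∈ σ, ∀ s, (d s).2 = true ↔ (d s).1 ∈ rel A s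

/-- The data in `σ` only mention numbers below `n`. -/
def Below (σ : List (Datum L)) (n : ℕ) : Prop :=
  ∀ d ∈ σ, ∀ s, ∀ i, (d s).1 i < n

theorem mem_rel_copy_fun (f : ℕ ≃ β) {k : ℕ} (F : L.Functions k) (a : Fin (k + 1) → ℕ) :
    a ∈ rel (copy f : L.Structure ℕ) (Sum.inl ⟨k, F⟩) ↔
      Language.Structure.funMap F (fun i : Fin k => f (a i.castSucc)) = f (a (Fin.last k)) :=
  f.symm_apply_eq

theorem mem_rel_copy_rel (f : ℕ ≃ β) {k : ℕ} (R : L.Relations k) (a : Fin k → ℕ) :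
    a ∈ rel (copy f : L.Structure ℕ) (Sum.inr ⟨k, R⟩) ↔
      Language.Structure.RelMap R (fun i => f (a i)) :=
  Iff.rfl

theorem agreeBelow_copy {f g : ℕ ≃ β} {n : ℕ} (h : ∀ i < n, f i = g i) :
    AgreeBelow (copy f : L.Structure ℕ) (copy g) n := by
  rintro (⟨k, F⟩ | ⟨k, R⟩) a ha
  · have key : ∀ i : Fin (k + 1), f (a i) = g (a i) := fun i => h _ (ha i)
    refine (mem_rel_copy_fun f F a).trans (Iff.trans ?_ (mem_rel_copy_fun g F a).symm)
    rw [funext fun i : Fin k => key i.castSucc, key (Fin.last k)]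
  · have key : ∀ i : Fin k, f (a i) = g (a i) := fun i => h _ (ha i)
    refine (mem_rel_copy_rel f R a).trans (Iff.trans ?_ (mem_rel_copy_rel g R a).symm)
    rw [funext key]

theorem AgreeBelow.correct {A B : L.Structure ℕ} {n : ℕ} (h : AgreeBelow A B n)
    {σ : List (Datum L)} (hσ : Below σ n) (hA : Correct σ A) : Correct σ B :=
  fun d hd s => (hA d hd s).trans (h s _ (hσ d hd s))

theorem AgreeBelow.symm {A B : L.Structure ℕ} {n : ℕ} (h : AgreeBelow A B n) :
    AgreeBelow B A n :=
  fun s a ha => (h s a ha).symm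

theorem Below.mono {σ : List (Datum L)} {m n : ℕ} (h : Below σ m) (hmn : m ≤ n) : Below σ n :=
  fun d hd s i => (h d hd s i).trans_le hmn

theorem exists_below [Finite L.Symbols] (σ : List (Datum L)) : ∃ n, Below σ n := by
  induction σ with
  | nil => exact ⟨0, by simp [Below]⟩
  | cons d σ ih =>
    obtain ⟨n, hn⟩ := ih
    have hfin : (Set.range fun p : Σ s : L.Symbols, Fin (arity s) => (d p.1).1 p.2).Finite :=
      Set.finite_range _
    obtain ⟨m, hm⟩ := hfin.bddAbove
    refine ⟨max n (m + 1), fun d' hd' s i => ?_⟩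
    rcases List.mem_cons.1 hd' with rfl | hd'
    · exact (Nat.lt_succ_of_le (hm ⟨⟨s, i⟩, rfl⟩)).trans_le (le_max_right _ _)
    · exact (hn d' hd' s i).trans_le (le_max_left _ _)

theorem exists_enumeration (L : Language) :
    ∃ q : ℕ → (s : L.Symbols) → Fin (arity s) → ℕ, ∀ s a, ∃ k, q k s = a := by
  choose q hq using fun s : L.Symbols => exists_surjective_nat (Fin (arity s) → ℕ)
  exact ⟨fun k s => q s k, fun s a => hq s a⟩

theorem isInformantFor_of_correct {I : ℕ → Datum L} {A : L.Structure ℕ}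
    (hI : ∀ k s, (I k s).2 = true ↔ (I k s).1 ∈ rel A s) (hall : ∀ s a, ∃ k, (I k s).1 = a) :
    IsInformantFor I A := by
  refine fun s => ⟨?_, ?_⟩
  · ext a
    constructor
    · rintro ⟨k, hk⟩
      simpa [hk] using hI k s
    · intro ha
      obtain ⟨k, rfl⟩ := hall s a
      exact ⟨k, Prod.ext rfl ((hI k s).2 ha)⟩
  · ext a
    constructor
    · rintro ⟨k, hk⟩
      simpa [hk] using hI k s
    · intro ha
      obtain ⟨k, rfl⟩ := hall s a
      exact ⟨k, Prod.ext rfl (Bool.eq_false_iff.2 fun h => ha ((hI k s).1 h))⟩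

theorem IsInformantFor.correct_initSeg {I : ℕ → Datum L} {A : L.Structure ℕ}
    (hI : IsInformantFor I A) (n : ℕ) : Correct (initSeg I n) A := by
  intro d hd s
  obtain ⟨k, -, rfl⟩ := List.mem_map.1 hd
  constructor
  · intro h
    exact (hI s).1.subset ⟨k, Prod.ext rfl h⟩
  · intro h
    by_contra h'
    exact (hI s).2.subset ⟨k, Prod.ext rfl (Bool.eq_false_iff.2 h')⟩ h

/-- Correct finite data extend to an informant. -/
theorem Correct.exists_informant {A : L.Structure ℕ} {σ : List (Datum L)} (hσ : Correct σ A) :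
    ∃ I : ℕ → Datum L, IsInformantFor I A ∧ ∀ n ≥ σ.length, σ <+: initSeg I n := by
  classical
  obtain ⟨q, hq⟩ := exists_enumeration L
  let e : ℕ → Datum L := fun k s => (q k s, decide (q k s ∈ rel A s))
  let I : ℕ → Datum L := fun k => (σ[k]?).getD (e (k - σ.length))
  have hlt : ∀ k (h : k < σ.length), I k = σ[k] := fun k h => by simp [I, h]
  have hge : ∀ k, I (k + σ.length) = e k := fun k => by simp [I]
  refine ⟨I, isInformantFor_of_correct ?_ ?_, ?_⟩
  · intro k s
    rcases lt_or_ge k σ.length with hk | hk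
    · rw [hlt k hk]
      exact hσ _ (List.getElem_mem hk) s
    · obtain ⟨k, rfl⟩ := Nat.exists_eq_add_of_le' hk
      rw [hge]
      simp [e]
  · intro s a
    obtain ⟨k, hk⟩ := hq s a
    exact ⟨k + σ.length, by rw [hge]; exact hk⟩
  · intro n hn
    have hσI : initSeg I σ.length = σ := by
      refine List.ext_getElem (by simp [initSeg]) fun k h1 h2 => ?_
      simp [initSeg, hlt k h2]
    obtain ⟨m, rfl⟩ := Nat.exists_eq_add_of_le hn
    conv_lhs => rw [← hσI]
    simp only [initSeg, List.range_add, List.map_append]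
    exact List.prefix_append _ _

/-! ### Conditions and the locking argument -/

/-- Finite correct data about a numbering of `β`, with a bound on the numbers mentioned. -/
structure Condition (L : Language) (β : Type*) [L.Structure β] where
  data : List (Datum L)
  num : ℕ ≃ β
  bound : ℕ
  correct : Correct data (copy num)
  below : Below data bound

/-- `d` extends `c`: it has more data, and the two numberings agree below the bound of `c`. -/
structure Condition.Extends (c d : Condition L β) : Prop where
  data : c.data <+: d.data
  bound : c.bound ≤ d.bound
  num : ∀ i < c.bound, d.num i = c.num i

theorem Condition.Extends.refl (c : Condition L β) : c.Extends c :=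
  ⟨List.prefix_rfl, le_rfl, fun _ _ => rfl⟩

theorem Condition.Extends.trans {c d e : Condition L β} (h : c.Extends d) (h' : d.Extends e) :
    c.Extends e :=
  ⟨h.data.trans h'.data, h.bound.trans h'.bound, fun i hi =>
    (h'.num i (hi.trans_le h.bound)).trans (h.num i hi)⟩

theorem Condition.exists_extends_datum [Finite L.Symbols] (c : Condition L β)
    (q : (s : L.Symbols) → Fin (arity s) → ℕ) (b : β) :
    ∃ d : Condition L β, c.Extends d ∧ c.data.length < d.data.length ∧
      (∃ x ∈ d.data, ∀ s, (x s).1 = q s) ∧ c.bound < d.bound ∧ ∃ k < d.bound, d.num k = b := by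
  classical
  let x : Datum L := fun s => (q s, decide (q s ∈ rel (copy c.num : L.Structure ℕ) s))
  obtain ⟨n, hn⟩ := exists_below (c.data ++ [x])
  refine ⟨⟨c.data ++ [x], c.num, max (max n (c.num.symm b + 1)) (c.bound + 1), ?_, ?_⟩,
    ⟨List.prefix_append _ _, ?_, fun _ _ => rfl⟩, by simp, ⟨x, by simp, fun _ => rfl⟩, ?_,
    c.num.symm b, ?_, by simp⟩
  · intro d hd s
    rcases List.mem_append.1 hd with hd | hd
    · exact c.correct d hd s
    · obtain rfl := List.mem_singleton.1 hd
      simp [x]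
  · exact hn.mono (by simp)
  · exact (Nat.le_succ _).trans (le_max_right _ _)
  · exact Nat.lt_of_succ_le (le_max_right _ _)
  · exact Nat.lt_of_succ_le ((le_max_right _ _).trans (le_max_left _ _))

/-- A sequence of conditions that decides every tuple and reaches every element of `β` determines
a numbering of `β` and an informant for it. -/
theorem exists_informant_of_conditions {c : ℕ → Condition L β}
    (hext : ∀ n, (c n).Extends (c (n + 1)))
    (hlen : ∀ n, (c n).data.length < (c (n + 1)).data.length)
    (hbound : ∀ n, (c n).bound < (c (n + 1)).bound)
    (htuple : ∀ s (a : Fin (arity s) → ℕ), ∃ n, ∃ x ∈ (c n).data, (x s).1 = a)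
    (hreach : ∀ b, ∃ n, ∃ k < (c n).bound, (c n).num k = b) :
    ∃ (f : ℕ ≃ β) (I : ℕ → Datum L), IsInformantFor I (copy f) ∧
      ∀ n, initSeg I (c n).data.length = (c n).data := by
  have hmono : ∀ m n, m ≤ n → (c m).Extends (c n) := by
    intro m n hmn
    induction n, hmn using Nat.le_induction with
    | base => exact Condition.Extends.refl _
    | succ n _ ih => exact ih.trans (hext n)
  have hb : ∀ n, n ≤ (c n).bound :=
    fun _ => (strictMono_nat_of_lt_succ hbound).le_apply
  have hl : ∀ n, n ≤ (c n).data.length :=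
    fun _ => (strictMono_nat_of_lt_succ (f := fun n => (c n).data.length) hlen).le_apply
  -- Bounds grow strictly, so `k` lies below the bound of `c (k + 1)` and its value is fixed from
  -- then on.
  let F : ℕ → β := fun k => (c (k + 1)).num k
  have hF : ∀ n, ∀ k < (c n).bound, F k = (c n).num k := by
    intro n k hk
    rcases le_total n (k + 1) with h | h
    · exact (hmono _ _ h).num k hk
    · exact ((hmono _ _ h).num k (hb (k + 1))).symm
  have hbij : Function.Bijective F := by
    constructor
    · intro i k hik
      have h1 : i < (c (max i k + 1)).bound := by have := hb (max i k + 1); omega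
      have h2 : k < (c (max i k + 1)).bound := by have := hb (max i k + 1); omega
      rw [hF _ i h1, hF _ k h2] at hik
      exact (c (max i k + 1)).num.injective hik
    · intro b
      obtain ⟨n, k, hk, rfl⟩ := hreach b
      exact ⟨k, hF n k hk⟩
  let f : ℕ ≃ β := Equiv.ofBijective F hbij
  have hcor : ∀ n, Correct (c n).data (copy f : L.Structure ℕ) := fun n =>
    (agreeBelow_copy fun i hi => (hF n i hi).symm).correct (c n).below (c n).correct
  have hpos : ∀ k, k < (c (k + 1)).data.length := fun k => hl (k + 1)
  let I : ℕ → Datum L := fun k => (c (k + 1)).data[k]'(hpos k)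
  have hI : ∀ n k (hk : k < (c n).data.length), I k = (c n).data[k] := by
    intro n k hk
    rcases le_total n (k + 1) with h | h
    · exact ((hmono _ _ h).data.getElem hk).symm
    · exact (hmono _ _ h).data.getElem (hpos k)
  refine ⟨f, I, isInformantFor_of_correct ?_ ?_, ?_⟩
  · intro k s
    exact hcor (k + 1) _ (List.getElem_mem _) s
  · intro s a
    obtain ⟨n, x, hx, rfl⟩ := htuple s a
    obtain ⟨k, hk, rfl⟩ := List.getElem_of_mem hx
    exact ⟨k, by rw [hI n k hk]⟩
  · intro n
    refine List.ext_getElem (by simp [initSeg]) fun k h1 h2 => ?_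
    simp [initSeg, hI n k h2]

/-- A learner that converges on all informants for all copies of `β` has a condition on all
extensions of which it makes the same conjecture. -/
theorem exists_locking_condition [Finite L.Symbols] (e₀ : ℕ ≃ β) (M : Learner L)
    (hM : ∀ (f : ℕ ≃ β) (I : ℕ → Datum L), IsInformantFor I (copy f) →
      ∃ e s₀ : ℕ, ∀ s ≥ s₀, M (initSeg I s) = some e) :
    ∃ (c : Condition L β) (e : ℕ), ∀ d, c.Extends d → M d.data = some e := by
  by_contra! hno
  obtain ⟨q, hq⟩ := exists_enumeration L
  -- With no locking condition, stage `n` can list the `n`th tuple, reach the `n`th element, and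
  -- then avoid the conjecture `n.unpair.1`. Unpairing makes every conjecture be avoided infinitely
  -- often.
  have step : ∀ (c : Condition L β) (n : ℕ), ∃ d : Condition L β, c.Extends d ∧
      c.data.length < d.data.length ∧ (∃ x ∈ d.data, ∀ s, (x s).1 = q n s) ∧ c.bound < d.bound ∧
      (∃ k < d.bound, d.num k = e₀ n) ∧ M d.data ≠ some n.unpair.1 := by
    intro c n
    obtain ⟨d, h1, h2, ⟨x, hx, hxq⟩, h4, k, hk, hkn⟩ := c.exists_extends_datum (q n) (e₀ n)
    obtain ⟨d', h, hne⟩ := hno d n.unpair.1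
    exact ⟨d', h1.trans h, h2.trans_le h.data.length_le, ⟨x, h.data.subset hx, hxq⟩,
      h4.trans_le h.bound, ⟨k, hk.trans_le h.bound, (h.num k hk).trans hkn⟩, hne⟩
  choose next h1 h2 h3 h4 h5 h6 using step
  let c₀ : Condition L β := ⟨[], e₀, 0, by simp [Correct], by simp [Below]⟩
  let c : ℕ → Condition L β := fun n => Nat.rec c₀ (fun n c => next c n) n
  obtain ⟨f, I, hI, hseg⟩ := exists_informant_of_conditions (c := c) (fun n => h1 _ _)
    (fun n => h2 _ _) (fun n => h4 _ _)
    (fun s a => by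
      obtain ⟨n, rfl⟩ := hq s a
      obtain ⟨x, hx, hxq⟩ := h3 (c n) n
      exact ⟨n + 1, x, hx, hxq s⟩)
    (fun b => ⟨e₀.symm b + 1, by simpa using h5 (c (e₀.symm b)) (e₀.symm b)⟩)
  obtain ⟨e, s₀, he⟩ := hM f I hI
  have hl : StrictMono fun n => (c n).data.length := strictMono_nat_of_lt_succ fun n => h2 _ _
  -- Stage `Nat.pair e s₀` avoids `e` with data of length above `s₀`, contradicting convergence to
  -- `e`.
  refine h6 (c (Nat.pair e s₀)) (Nat.pair e s₀) ?_
  change M (c (Nat.pair e s₀ + 1)).data = _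
  rw [Nat.unpair_pair, ← hseg (Nat.pair e s₀ + 1)]
  refine he _ ?_
  have := hl.le_apply (x := Nat.pair e s₀ + 1)
  have := Nat.right_le_pair e s₀
  omega

end Copies

/-! ### Transfer of data between Boolean algebras and the common conjecture -/

section BooleanCopies

variable {α β : Type*} [BooleanAlgebra α] [BooleanAlgebra β]

attribute [local instance] boolStructure

/-- Each operation acts on joins through union, intersection or complement of index sets,
identically on both sides, so every atomic fact reduces to an equation between joins. -/
theorem Matched.agreeBelow {f : ℕ ≃ α} {g : ℕ ≃ β} {n : ℕ} (h : Matched f g n) :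
    AgreeBelow (copy f : boolLang.Structure ℕ) (copy g) n := by
  classical
  obtain ⟨τ, _, y, x, S, hy, hx, h0, hS⟩ := h
  rintro (⟨k, F⟩ | ⟨k, R⟩) a ha
  · suffices key : ∀ a : Fin (k + 1) → ℕ, (∀ i, a i < n) →
        (Language.Structure.funMap (L := boolLang) F (fun i : Fin k => f (a i.castSucc)) =
          f (a (Fin.last k)) ↔
        Language.Structure.funMap (L := boolLang) F (fun i : Fin k => g (a i.castSucc)) =
          g (a (Fin.last k))) from
      (mem_rel_copy_fun f F a).trans ((key a ha).trans (mem_rel_copy_fun g F a).symm)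
    clear a ha
    intro a ha
    simp only [fun i => (hS _ (ha i)).1, fun i => (hS _ (ha i)).2]
    cases F
    · change _ ⊔ _ = _ ↔ _ ⊔ _ = _
      rw [← Finset.sup_union, ← Finset.sup_union, hy.sup_eq_sup_iff hx h0]
    · change _ ⊓ _ = _ ↔ _ ⊓ _ = _
      rw [hy.sup_inf_sup, hx.sup_inf_sup, hy.sup_eq_sup_iff hx h0]
    · change _ᶜ = _ ↔ _ᶜ = _
      rw [hy.compl_sup, hx.compl_sup, hy.sup_eq_sup_iff hx h0]
    · change ⊥ = _ ↔ ⊥ = _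
      rw [← Finset.sup_empty (f := y), ← Finset.sup_empty (f := x), hy.sup_eq_sup_iff hx h0]
    · change ⊤ = _ ↔ ⊤ = _
      rw [← hy.sup_eq_top, ← hx.sup_eq_top, hy.sup_eq_sup_iff hx h0]
  · exact R.elim

theorem Matched.apply_eq_iff {a : ℕ → α} {b : ℕ → β} {n : ℕ} (h : Matched a b n) {i k : ℕ}
    (hi : i < n) (hk : k < n) : a i = a k ↔ b i = b k := by
  obtain ⟨τ, _, y, x, S, hy, hx, h0, hS⟩ := h
  rw [(hS i hi).1, (hS k hk).1, (hS i hi).2, (hS k hk).2, hy.sup_eq_sup_iff hx h0]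

theorem Matched.congr {a a' : ℕ → α} {b b' : ℕ → β} {n : ℕ} (h : Matched a b n)
    (ha : ∀ i < n, a' i = a i) (hb : ∀ i < n, b' i = b i) : Matched a' b' n := by
  obtain ⟨τ, _, y, x, S, hy, hx, h0, hS⟩ := h
  exact ⟨τ, _, y, x, S, hy, hx, h0, fun i hi => by rw [ha i hi, hb i hi]; exact hS i hi⟩

theorem exists_numbering_extending {γ : Type*} (e : ℕ ≃ γ) (a : ℕ → γ) (n : ℕ)
    (ha : ∀ i < n, ∀ k < n, a i = a k → i = k) : ∃ g : ℕ ≃ γ, ∀ i < n, g i = a i := by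
  obtain ⟨g, hg⟩ := Cardinal.extend_function_of_lt (s := Set.Iio n)
    ⟨fun i => a i, fun i k h => Subtype.ext (ha i i.2 k k.2 h)⟩
    (by simp) ⟨e⟩
  exact ⟨g, fun i hi => hg ⟨i, hi⟩⟩

/-- If `α` has at least as many atoms as `β`, then a learner that succeeds on all copies of both
makes the same conjecture on some copy of each. -/
theorem exists_common_conjecture (eα : ℕ ≃ α) (eβ : ℕ ≃ β)
    (j : AtomOf β ↪ AtomOf α) (M : Learner boolLang)
    (Pα Pβ : ℕ → Prop)
    (hα : ∀ (f : ℕ ≃ α) (I : ℕ → Datum boolLang), IsInformantFor I (copy f) →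
      ∃ e s₀ : ℕ, Pα e ∧ ∀ s ≥ s₀, M (initSeg I s) = some e)
    (hβ : ∀ (f : ℕ ≃ β) (I : ℕ → Datum boolLang), IsInformantFor I (copy f) →
      ∃ e s₀ : ℕ, Pβ e ∧ ∀ s ≥ s₀, M (initSeg I s) = some e) :
    ∃ e, Pα e ∧ Pβ e := by
  have : Infinite α := Infinite.of_injective _ eα.injective
  have : Infinite β := Infinite.of_injective _ eβ.injective
  obtain ⟨c, e, hc⟩ := exists_locking_condition eβ M fun f I hI =>
    let ⟨e, s₀, _, h⟩ := hβ f I hI; ⟨e, s₀, h⟩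
  obtain ⟨a, hmatch, hext⟩ := exists_matched_extendable j c.num c.bound
  obtain ⟨g, hg⟩ := exists_numbering_extending eα a c.bound fun i hi k hk h =>
    c.num.injective ((hmatch.apply_eq_iff hi hk).1 h)
  have hcg : Correct c.data (copy g : boolLang.Structure ℕ) :=
    (hmatch.congr hg fun _ _ => rfl).agreeBelow.symm.correct c.below c.correct
  -- A segment of the `α`-informant past convergence is imitated by a renumbering of `β` that agrees
  -- with `c.num` below `c.bound`, so locking forces `e` on it.
  have hPα : Pα e := by
    obtain ⟨I, hI, hpre⟩ := hcg.exists_informant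
    obtain ⟨e', s₀, he', hconv⟩ := hα g I hI
    obtain ⟨m, hm⟩ := exists_below (initSeg I (max s₀ c.data.length))
    obtain ⟨b, hb, hgb⟩ := hext g hg (max m c.bound)
    obtain ⟨f, hf⟩ := exists_numbering_extending eβ b (max m c.bound) fun i hi k hk h =>
      g.injective ((hgb.apply_eq_iff hi hk).2 h)
    have hbelow := hm.mono (le_max_left m c.bound)
    have hd := hc ⟨_, f, max m c.bound,
      (hgb.congr (fun _ _ => rfl) hf).agreeBelow.correct hbelow (hI.correct_initSeg _), hbelow⟩
      ⟨hpre _ (le_max_right _ _), le_max_right _ _, fun i hi =>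
        (hf i (hi.trans_le (le_max_right _ _))).trans (hb i hi)⟩
    rw [hconv _ (le_max_left _ _)] at hd
    exact Option.some.inj hd ▸ he'
  -- No imitation is needed here: an informant for `c.num` itself extends the locking data.
  have hPβ : Pβ e := by
    obtain ⟨I, hI, hpre⟩ := c.correct.exists_informant
    obtain ⟨e', s₀, he', hconv⟩ := hβ c.num I hI
    obtain ⟨m, hm⟩ := exists_below (initSeg I (max s₀ c.data.length))
    have hd := hc ⟨_, c.num, max m c.bound, hI.correct_initSeg _, hm.mono (le_max_left _ _)⟩
      ⟨hpre _ (le_max_right _ _), le_max_right _ _, fun _ _ => rfl⟩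
    rw [hconv _ (le_max_left _ _)] at hd
    exact Option.some.inj hd ▸ he'
  exact ⟨e, hPα, hPβ⟩

end BooleanCopies

theorem Isomorphic.symm {L : Language} {A B : L.Structure ℕ} (h : Isomorphic A B) :
    Isomorphic B A :=
  h.map fun e => @Language.Equiv.symm L ℕ ℕ A B e

theorem Isomorphic.trans {L : Language} {A B D : L.Structure ℕ} (h : Isomorphic A B)
    (h' : Isomorphic B D) : Isomorphic A D :=
  let ⟨e⟩ := h
  let ⟨e'⟩ := h'
  ⟨@Language.Equiv.comp L ℕ ℕ A B ℕ D e' e⟩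

theorem isomorphic_copy {L : Language} (A : L.Structure ℕ) (f : ℕ ≃ ℕ) :
    Isomorphic A (@copy L ℕ A f) :=
  ⟨@Equiv.inducedStructureEquiv L ℕ ℕ A f.symm⟩

/-- Closure of `C` under isomorphism makes the learner succeed on every copy; the common conjecture
would then be isomorphic to both algebras. -/
theorem not_isLearnable_of_embedding (bA bB : BooleanAlgebra ℕ)
    (j : @AtomOf ℕ bB ↪ @AtomOf ℕ bA)
    {ν : ℕ → boolLang.Structure ℕ} {C : Set (boolLang.Structure ℕ)} (hC : IsoClosed C)
    (hA : @boolStructure ℕ bA ∈ C) (hB : @boolStructure ℕ bB ∈ C)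
    (hne : ¬ Isomorphic (@boolStructure ℕ bA) (@boolStructure ℕ bB)) : ¬ IsLearnable ν C := by
  rintro ⟨M, hM⟩
  have hcopy : ∀ D ∈ C, ∀ (f : ℕ ≃ ℕ) (I : ℕ → Datum boolLang),
      IsInformantFor I (@copy boolLang ℕ D f) →
        ∃ e s₀ : ℕ, Isomorphic (ν e) D ∧ ∀ s ≥ s₀, M (initSeg I s) = some e := by
    intro D hD f I hI
    obtain ⟨e, s₀, he, h⟩ := hM _ (hC _ _ hD (isomorphic_copy D f)) I hI
    exact ⟨e, s₀, he.trans (isomorphic_copy D f).symm, h⟩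
  obtain ⟨e, h1, h2⟩ := @exists_common_conjecture ℕ ℕ bA bB (Equiv.refl ℕ) (Equiv.refl ℕ) j M
    (fun e => Isomorphic (ν e) (@boolStructure ℕ bA))
    (fun e => Isomorphic (ν e) (@boolStructure ℕ bB)) (hcopy _ hA) (hcopy _ hB)
  exact hne (h1.symm.trans h2)

end InformantLearning

theorem mainTheorem2
    (K : Set (InformantLearning.boolLang.Structure ℕ))
    (hKiso : InformantLearning.IsoClosed K)
    (hK : ∀ A ∈ K, InformantLearning.IsBooleanAlgebra A)
    (ν : ℕ → InformantLearning.boolLang.Structure ℕ)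
    (hν : InformantLearning.IsEffectiveEnumeration K ν)
    (C : Set (InformantLearning.boolLang.Structure ℕ))
    (hCiso : InformantLearning.IsoClosed C)
    (hCK : C ⊆ K)
    (hC : ∃ A ∈ C, ∃ B ∈ C, ¬ InformantLearning.Isomorphic A B) :
    ¬ InformantLearning.IsLearnable ν C := by
  obtain ⟨A, hA, B, hB, hne⟩ := hC
  obtain ⟨bA, rfl⟩ := hK A (hCK hA)
  obtain ⟨bB, rfl⟩ := hK B (hCK hB)
  -- Cardinals are comparable, so one of the two atom sets embeds in the other.
  rcases Function.Embedding.total (@InformantLearning.AtomOf ℕ bB)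
      (@InformantLearning.AtomOf ℕ bA) with ⟨⟨j⟩⟩ | ⟨⟨j⟩⟩
  · exact InformantLearning.not_isLearnable_of_embedding bA bB j hCiso hA hB hne
  · exact InformantLearning.not_isLearnable_of_embedding bB bA j hCiso hB hA
      fun h => hne h.symm
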